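/- Let $G$ be a subgroup of $SU_2$ acting on $V=\mathbb C^2$ by matrix multiplication and diagonally on $V^{\otimes n}$ ($V^{\otimes 0}=\mathbb C$ trivial). Let $Z_n=\mathrm{End}_G(V^{\otimes n})$, and identify $a\in \mathrm{End}(V^{\otimes n})$ with $a\otimes \mathbf 1\in \mathrm{End}(V^{\otimes (n+1)})$. For $1\le j<n$ let $e_j=1-s_j$ on $V^{\otimes n}$, where $s_j$ exchanges the tensor factors in positions $j$ and $j+1$. Let $\varepsilon_{n+1}:\mathrm{End}(V^{\otimes (n+1)})\to \mathrm{End}(V^{\otimes n})$ be half the partial trace over the last tensor factor. Call an irreducible $G$-module new in $V^{\otimes n}$ if it is isomorphic to a direct summand of $V^{\otimes n}$ but not to one of $V^{\otimes (n-2)}$ (the second condition being void for $n<2$). Say that $f\in Z_n$ projects $V^{\otimes n}$ onto a $G$-module $W$ if $f^2=f$ and the image of $f$ is isomorphic to $W$ as a $G$-module. Let $k\ge 0$, and let $G^\lambda$, $G^\mu$, $G^\nu$ be irreducible $G$-modules of dimensions $d^\lambda,d^\mu,d^\nu$ that are new in $V^{\otimes k}$, $V^{\otimes (k+1)}$, $V^{\otimes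 (k+2)}$ respectively. Suppose that $f_\lambda\in Z_k$ projects $V^{\otimes k}$ onto $G^\lambda$, that $f_\mu\in Z_{k+1}$ projects $V^{\otimes (k+1)}$ onto $G^\mu$, and that $G^\mu\otimes V\cong G^\lambda\oplus G^\nu$. Set $$f_\nu=f_\mu-\frac{d^\lambda}{d^\mu}\,f_\mu e_{k+1}f_\mu\in \mathrm{End}(V^{\otimes (k+2)}).$$ Then: (i) $f_\nu$ is an idempotent in $Z_{k+2}$; (ii) $f_\mu f_\nu=f_\nu=f_\nu f_\mu$; (iii) $f_\nu$ commutes with $e_j$ for all $j>k+2$ (in $\mathrm{End}(V^{\otimes n})$ for every $n>j$); (iv) $e_{k+2}f_\nu e_{k+2}=\frac{d^\nu}{d^\mu}f_\mu e_{k+2}$, and $\varepsilon_{k+2}(f_\nu)=\frac{d^\nu}{2d^\mu}f_\mu$; (v) $f_\nu$ projects $V^{\otimes (k+2)}$ onto $G^\nu$. -/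

import Mathlib

open scoped TensorProduct

noncomputable section

namespace McKay

/-- The group `SU₂` of special unitary complex `2 × 2` matrices. -/
abbrev SU2 : Type := Matrix.specialUnitaryGroup (Fin 2) ℂ

/-- The defining module `V = ℂ²`. -/
abbrev V : Type := Fin 2 → ℂ

/-- The tensor power `V^{⊗ n}`. -/
abbrev VT (n : ℕ) : Type := ⨂[ℂ]^n V

/-- The action of a subgroup `G ≤ SU₂` on `V = ℂ²` by matrix multiplication. -/
def defRep (G : Subgroup SU2) : Representation ℂ G V where
  toFun g := Matrix.toLin' (((g : SU2) : Matrix (Fin 2) (Fin 2) ℂ))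
  map_one' := by simp [Module.End.one_eq_id]
  map_mul' g h := by simp [Matrix.toLin'_mul, Module.End.mul_eq_comp]

/-- The diagonal action of `G` on `V^{⊗ n}`, given by
`g (v₁ ⊗ ⋯ ⊗ vₙ) = g v₁ ⊗ ⋯ ⊗ g vₙ`. -/
def tensorRep (G : Subgroup SU2) (n : ℕ) : Representation ℂ G (VT n) where
  toFun g := PiTensorProduct.map (fun _ : Fin n => defRep G g)
  map_one' := by
    simp only [map_one]
    exact PiTensorProduct.map_one
  map_mul' g h := by
    simp only [map_mul]
    exact PiTensorProduct.map_mul _ _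

/-- The centralizer algebra `Z_n(G) = End_G(V^{⊗ n})`. -/
def Z (G : Subgroup SU2) (n : ℕ) : Subalgebra ℂ (Module.End ℂ (VT n)) :=
  Subalgebra.centralizer ℂ (Set.range (tensorRep G n))

/-- The embedding `a ↦ a ⊗ 1^{⊗ m}` of `End(V^{⊗ n})` into `End(V^{⊗ (n + m)})`: `a` acts on the
first `n` tensor factors, the identity acts on the last `m`. -/
def ext {n : ℕ} (m : ℕ) (a : Module.End ℂ (VT n)) : Module.End ℂ (VT (n + m)) :=
  (TensorPower.mulEquiv (R := ℂ) (M := V) (n := n) (m := m)).conj (TensorProduct.map a LinearMap.id)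

/-- The Temperley-Lieb generator `e_j = 1 - s_j` on `V^{⊗ n}`, `1 ≤ j ≤ n - 1`, where `s_j`
exchanges the tensor factors in the positions `j` and `j + 1`. Positions are counted from `1`
here, while `Fin n` starts at `0`. -/
def e (n j : ℕ) (h1 : 1 ≤ j) (h2 : j < n) : Module.End ℂ (VT n) :=
  1 - (PiTensorProduct.reindex ℂ (fun _ : Fin n => V)
    (Equiv.swap (⟨j - 1, by omega⟩ : Fin n) ⟨j, h2⟩)).toLinearMap

/-- The basis of simple tensors `v_r = v_{r₁} ⊗ ⋯ ⊗ v_{rₙ}` of `V^{⊗ n}`; the two standard basis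
vectors of `V` are indexed by `Fin 2`. -/
def stdBasis (n : ℕ) : Module.Basis (Fin n → Fin 2) ℂ (VT n) :=
  Basis.piTensorProduct (fun _ : Fin n => Pi.basisFun ℂ (Fin 2))

/-- The conditional expectation `ε : End(V^{⊗ (n+1)}) → End(V^{⊗ n})`: half the partial trace over
the last tensor factor, given on matrices with respect to the bases of simple tensors by
`ε(a)_{p,q} = ½ ∑_t a_{[p,t],[q,t]}`. -/
def condExp {n : ℕ} (a : Module.End ℂ (VT (n + 1))) : Module.End ℂ (VT n) :=
  Matrix.toLin (stdBasis n) (stdBasis n) (Matrix.of fun p q : Fin n → Fin 2 =>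
    (1 / 2 : ℂ) * ∑ t : Fin 2, LinearMap.toMatrix (stdBasis (n + 1)) (stdBasis (n + 1)) a
      (Fin.snoc (α := fun _ => Fin 2) p t) (Fin.snoc (α := fun _ => Fin 2) q t))

/-- The representation `ρ` is (isomorphic to) a direct summand of `V^{⊗ n}`. For irreducible `ρ`
this says that the label of `ρ` lies in `Λ_n(G)`. -/
def IsSummand {G : Subgroup SU2} {W : Type*} [AddCommGroup W] [Module ℂ W]
    (ρ : Representation ℂ G W) (n : ℕ) : Prop :=
  ∃ (i : Representation.IntertwiningMap ρ (tensorRep G n))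
    (p : Representation.IntertwiningMap (tensorRep G n) ρ), ∀ w : W, p (i w) = w

/-- The representation `ρ` is new in `V^{⊗ n}`: it is a summand of `V^{⊗ n}` but not of
`V^{⊗ (n - 2)}` (for `n < 2` the second condition is void). For irreducible `ρ` this says that
the label of `ρ` lies in `Λ_n(G) \ Λ_{n-2}(G)`. -/
def IsNew {G : Subgroup SU2} {W : Type*} [AddCommGroup W] [Module ℂ W]
    (ρ : Representation ℂ G W) (n : ℕ) : Prop :=
  IsSummand ρ n ∧ ∀ m : ℕ, m + 2 = n → ¬ IsSummand ρ m

/-- The endomorphism `f` projects `V^{⊗ n}` onto a copy of the `G`-module given by `ρ`: it is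
idempotent, and its image is a `G`-submodule of `V^{⊗ n}` that is isomorphic to `ρ`. -/
def ProjectsOnto {G : Subgroup SU2} {n : ℕ} (f : Module.End ℂ (VT n)) {W : Type*} [AddCommGroup W]
    [Module ℂ W] (ρ : Representation ℂ G W) : Prop :=
  IsIdempotentElem f ∧
    ∃ i : Representation.IntertwiningMap ρ (tensorRep G n),
      Function.Injective i ∧ LinearMap.range i.toLinearMap = LinearMap.range f

end McKay

end

open scoped TensorProduct

noncomputable section

namespace McKay

/-! On the last two factors `1 - s` is the rank-one map `cup ∘ cap` built from the antisymmetric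
vector and the determinant form, so `e_{k+1}` factors `G`-equivariantly through `V^{⊗k}` (`e_eq`).
The idempotent `f_μ ⊗ 1` has image `G^μ ⊗ V ≅ G^λ ⊕ G^ν`. Since `G^ν` is not a summand of `V^{⊗k}`
while `G^λ` is, Schur's lemma kills every block of `f_μ e_{k+1} f_μ` except `G^λ → G^λ`, which is a
scalar `c` (`exists_eq_smul_of_factors`). Partial trace preserves the trace and sends `f_μ e_{k+1}
f_μ` to `f_μ`, up to the factor 2, so `c d^λ = d^μ`. Thus `f_ν` is `f_μ ⊗ 1` minus the projection
onto `G^λ`, that is, the projection onto `G^ν` (`exists_splitting_sub_smul`); this gives (i), (ii),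
(v). Part (iv) follows from `e b e = 2ε(b) e` (`e_ext_e`) and `2d^μ = d^λ + d^ν`; part (iii) is
disjointness of tensor positions. -/

/-! ### Adding and removing the last tensor factor. -/

/-- The map `x ↦ x ⊗ v`, bilinear in `v` and `x`. -/
def append (n : ℕ) : V →ₗ[ℂ] VT n →ₗ[ℂ] VT (n + 1) :=
  (((TensorProduct.mk ℂ (VT n) (VT 1)).compr₂
    (TensorPower.mulEquiv (R := ℂ) (M := V) (n := n) (m := 1)).toLinearMap).flip).comp
    (PiTensorProduct.subsingletonEquiv (R := ℂ) (s := fun _ : Fin 1 => V) 0).symm.toLinearMap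

theorem append_apply {n : ℕ} (v : V) (x : VT n) :
    append n v x = TensorPower.mulEquiv (R := ℂ) (M := V) (n := n) (m := 1)
      (x ⊗ₜ[ℂ] PiTensorProduct.tprod ℂ fun _ : Fin 1 => v) := by
  simp only [append, LinearMap.comp_apply, LinearEquiv.coe_coe, LinearMap.flip_apply,
    LinearMap.compr₂_apply, TensorProduct.mk_apply]
  congr 2
  rw [LinearEquiv.symm_apply_eq]
  simp

theorem mulEquiv_tprod {n m : ℕ} (u : Fin n → V) (w : Fin m → V) :
    TensorPower.mulEquiv (R := ℂ) (PiTensorProduct.tprod ℂ u ⊗ₜ[ℂ] PiTensorProduct.tprod ℂ w) =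
      PiTensorProduct.tprod ℂ (Fin.append u w) :=
  TensorPower.tprod_mul_tprod ℂ u w

theorem append_tprod {n : ℕ} (v : V) (u : Fin n → V) :
    append n v (PiTensorProduct.tprod ℂ u) =
      PiTensorProduct.tprod ℂ (Fin.snoc (α := fun _ => V) u v) := by
  rw [append_apply, mulEquiv_tprod, Fin.append_right_eq_snoc]

/-- Appending the standard basis vector `v_t`. -/
def cr (n : ℕ) (t : Fin 2) : VT n →ₗ[ℂ] VT (n + 1) := append n (Pi.basisFun ℂ (Fin 2) t)

theorem stdBasis_apply {n : ℕ} (q : Fin n → Fin 2) :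
    stdBasis n q = PiTensorProduct.tprod ℂ fun i => Pi.basisFun ℂ (Fin 2) (q i) :=
  Basis.piTensorProduct_apply _ _

theorem cr_stdBasis {n : ℕ} (t : Fin 2) (q : Fin n → Fin 2) :
    cr n t (stdBasis n q) = stdBasis (n + 1) (Fin.snoc (α := fun _ => Fin 2) q t) := by
  rw [stdBasis_apply, cr, append_tprod, stdBasis_apply]
  congr 1
  ext i : 1
  refine Fin.lastCases ?_ (fun i => ?_) i <;> simp

/-- Contraction of the last tensor factor against the dual basis vector `v_t^*`. -/
def an (n : ℕ) (t : Fin 2) : VT (n + 1) →ₗ[ℂ] VT n :=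
  (stdBasis (n + 1)).constr ℂ fun r => if r (Fin.last n) = t then stdBasis n (Fin.init r) else 0

theorem an_stdBasis {n : ℕ} (t : Fin 2) (r : Fin (n + 1) → Fin 2) :
    an n t (stdBasis (n + 1) r) = if r (Fin.last n) = t then stdBasis n (Fin.init r) else 0 :=
  Module.Basis.constr_basis _ _ _ _

theorem an_comp_cr {n : ℕ} (s t : Fin 2) :
    an n s ∘ₗ cr n t = if t = s then LinearMap.id else 0 := by
  refine (stdBasis n).ext fun q => ?_
  rw [LinearMap.comp_apply, cr_stdBasis, an_stdBasis, Fin.snoc_last, Fin.init_snoc]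
  split_ifs <;> rfl

theorem an_cr_apply {n : ℕ} (s t : Fin 2) (x : VT n) :
    an n s (cr n t x) = if t = s then x else 0 := by
  rw [← LinearMap.comp_apply, an_comp_cr]
  split_ifs <;> rfl

/-- With `an_comp_cr` this splits `V^{⊗(n+1)}` into two copies of `V^{⊗n}`, so operator identities
can be checked on the vectors `cr n t x`. -/
theorem sum_cr_an {n : ℕ} (x : VT (n + 1)) : cr n 0 (an n 0 x) + cr n 1 (an n 1 x) = x := by
  have : cr n 0 ∘ₗ an n 0 + cr n 1 ∘ₗ an n 1 = LinearMap.id := by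
    refine (stdBasis (n + 1)).ext fun r => ?_
    rw [LinearMap.add_apply, LinearMap.comp_apply, LinearMap.comp_apply, an_stdBasis, an_stdBasis,
      LinearMap.id_apply]
    have h := Fin.snoc_init_self r
    generalize r (Fin.last n) = t at h ⊢
    fin_cases t <;> simp [cr_stdBasis] <;> rw [← h] <;> simp
  exact LinearMap.congr_fun this x

theorem ext_mulEquiv {n m : ℕ} (a : Module.End ℂ (VT n)) (x : VT n) (y : VT m) :
    ext m a (TensorPower.mulEquiv (R := ℂ) (x ⊗ₜ[ℂ] y)) =
      TensorPower.mulEquiv (R := ℂ) (a x ⊗ₜ[ℂ] y) := by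
  simp [ext, LinearEquiv.conj_apply]

theorem ext_append {n : ℕ} (a : Module.End ℂ (VT n)) (v : V) (x : VT n) :
    ext 1 a (append n v x) = append n v (a x) := by
  rw [append_apply, append_apply, ext_mulEquiv]

theorem ext_cr {n : ℕ} (a : Module.End ℂ (VT n)) (t : Fin 2) (x : VT n) :
    ext 1 a (cr n t x) = cr n t (a x) := ext_append a _ x

theorem ext_eq {n : ℕ} (a : Module.End ℂ (VT n)) (x : VT (n + 1)) :
    ext 1 a x = cr n 0 (a (an n 0 x)) + cr n 1 (a (an n 1 x)) := by
  conv_lhs => rw [← sum_cr_an x, map_add, ext_cr, ext_cr]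

theorem an_ext {n : ℕ} (a : Module.End ℂ (VT n)) (t : Fin 2) (x : VT (n + 1)) :
    an n t (ext 1 a x) = a (an n t x) := by
  rw [ext_eq, map_add, an_cr_apply, an_cr_apply]
  fin_cases t <;> simp

theorem ext_smul {n m : ℕ} (c : ℂ) (a : Module.End ℂ (VT n)) : ext m (c • a) = c • ext m a := by
  rw [ext, ext, TensorProduct.map_smul_left, map_smul]

theorem repr_an {n : ℕ} (t : Fin 2) (x : VT (n + 1)) (p : Fin n → Fin 2) :
    (stdBasis n).repr (an n t x) p =
      (stdBasis (n + 1)).repr x (Fin.snoc (α := fun _ => Fin 2) p t) := by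
  have : ((stdBasis n).coord p) ∘ₗ an n t =
      (stdBasis (n + 1)).coord (Fin.snoc (α := fun _ => Fin 2) p t) := by
    refine (stdBasis (n + 1)).ext fun r => ?_
    have h := Fin.snoc_init_self r
    rw [← h, LinearMap.comp_apply, an_stdBasis, Fin.snoc_last, Fin.init_snoc,
      Module.Basis.coord_apply, Module.Basis.coord_apply, Module.Basis.repr_self]
    split_ifs with h1
    · simp [Finsupp.single_apply, Fin.snoc_inj, h1]
    · simp only [map_zero, Finsupp.single_apply, Fin.snoc_inj, h1, and_false, if_false]
      rfl
  exact LinearMap.congr_fun this x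

/-! ### Partial trace. -/

/-- Coordinate-free form of the matrix definition; the factor 2 clears the normalisation and is kept
throughout. -/
theorem two_condExp {n : ℕ} (a : Module.End ℂ (VT (n + 1))) :
    (2 : ℂ) • condExp a = an n 0 ∘ₗ a ∘ₗ cr n 0 + an n 1 ∘ₗ a ∘ₗ cr n 1 := by
  refine (stdBasis n).ext fun q => (stdBasis n).ext_elem fun p => ?_
  have h : (stdBasis n).repr (condExp a (stdBasis n q)) p =
      (1 / 2 : ℂ) * ∑ t : Fin 2, LinearMap.toMatrix (stdBasis (n + 1)) (stdBasis (n + 1)) a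
        (Fin.snoc (α := fun _ => Fin 2) p t) (Fin.snoc (α := fun _ => Fin 2) q t) := by
    rw [← LinearMap.toMatrix_apply, condExp, LinearMap.toMatrix_toLin, Matrix.of_apply]
  rw [LinearMap.smul_apply, map_smul, Finsupp.smul_apply, h, LinearMap.add_apply, map_add,
    Finsupp.add_apply]
  simp only [LinearMap.toMatrix_apply, LinearMap.comp_apply, repr_an, cr_stdBasis,
    Fin.sum_univ_two, smul_eq_mul]
  ring

/-- Insert `1 = ∑ cr ∘ an` to the right of `a` and use cyclicity of the trace to move `an` to the
left. -/
theorem trace_eq {n : ℕ} (a : Module.End ℂ (VT (n + 1))) :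
    LinearMap.trace ℂ _ a = LinearMap.trace ℂ _ ((2 : ℂ) • condExp a) := by
  have h : a = (a ∘ₗ cr n 0) ∘ₗ an n 0 + (a ∘ₗ cr n 1) ∘ₗ an n 1 := by
    refine LinearMap.ext fun x => ?_
    simp only [LinearMap.add_apply, LinearMap.comp_apply, ← map_add, sum_cr_an]
  have : Module.Finite ℂ (VT n) := Module.Finite.of_basis (stdBasis n)
  have : Module.Finite ℂ (VT (n + 1)) := Module.Finite.of_basis (stdBasis (n + 1))
  rw [two_condExp]
  conv_lhs => rw [h]
  rw [map_add, map_add, LinearMap.trace_comp_comm', LinearMap.trace_comp_comm' (an n 1)]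

/-! ### Temperley-Lieb relations through cup and cap. -/

/-- The equivariant embedding `x ↦ x ⊗ v₀ ⊗ v₁ - x ⊗ v₁ ⊗ v₀`. -/
def cup (n : ℕ) : VT n →ₗ[ℂ] VT (n + 1 + 1) :=
  cr (n + 1) 1 ∘ₗ cr n 0 - cr (n + 1) 0 ∘ₗ cr n 1

/-- Contraction of the last two tensor factors against the determinant form. -/
def cap (n : ℕ) : VT (n + 1 + 1) →ₗ[ℂ] VT n :=
  an n 0 ∘ₗ an (n + 1) 1 - an n 1 ∘ₗ an (n + 1) 0

theorem reindex_swap_cr {n : ℕ} (h1 : n < n + 1 + 1) (h2 : n + 1 < n + 1 + 1)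
    (s t : Fin 2) (x : VT n) :
    PiTensorProduct.reindex ℂ (fun _ : Fin (n + 1 + 1) => V)
      (Equiv.swap (⟨n, h1⟩ : Fin (n + 1 + 1)) ⟨n + 1, h2⟩) (cr (n + 1) t (cr n s x)) =
      cr (n + 1) s (cr n t x) := by
  have : (PiTensorProduct.reindex ℂ (fun _ : Fin (n + 1 + 1) => V)
      (Equiv.swap (⟨n, h1⟩ : Fin (n + 1 + 1)) ⟨n + 1, h2⟩)).toLinearMap ∘ₗ cr (n + 1) t ∘ₗ cr n s =
      cr (n + 1) s ∘ₗ cr n t := by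
    refine (stdBasis n).ext fun q => ?_
    simp only [LinearMap.comp_apply, cr_stdBasis, LinearEquiv.coe_coe]
    rw [stdBasis_apply, stdBasis_apply]
    refine (PiTensorProduct.reindex_tprod _ _).trans ?_
    congr 1
    ext i : 1
    have e1 : (⟨n, h1⟩ : Fin (n + 1 + 1)) = (Fin.last n).castSucc := rfl
    have e2 : (⟨n + 1, h2⟩ : Fin (n + 1 + 1)) = Fin.last (n + 1) := rfl
    rw [Equiv.symm_swap, e1, e2]
    refine Fin.lastCases ?_ (fun i => ?_) i
    · rw [Equiv.swap_apply_right]; simp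
    · refine Fin.lastCases ?_ (fun i => ?_) i
      · rw [Equiv.swap_apply_left]; simp
      · rw [Equiv.swap_apply_of_ne_of_ne]
        · simp
        · simp [Fin.ext_iff, i.isLt.ne]
        · simp [Fin.ext_iff]; omega
  exact LinearMap.congr_fun this x

theorem e_eq {n : ℕ} (h1 : 1 ≤ n + 1) (h2 : n + 1 < n + 1 + 1) :
    e (n + 1 + 1) (n + 1) h1 h2 = cup n ∘ₗ cap n := by
  have key (s t : Fin 2) (x : VT n) : e (n + 1 + 1) (n + 1) h1 h2 (cr (n + 1) t (cr n s x)) =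
      (cup n ∘ₗ cap n) (cr (n + 1) t (cr n s x)) := by
    have h : e (n + 1 + 1) (n + 1) h1 h2 (cr (n + 1) t (cr n s x)) =
        cr (n + 1) t (cr n s x) - cr (n + 1) s (cr n t x) :=
      congrArg (cr (n + 1) t (cr n s x) - ·) (reindex_swap_cr _ _ s t x)
    rw [h]
    simp only [cup, cap, LinearMap.comp_apply, LinearMap.sub_apply, an_cr_apply]
    obtain rfl | rfl : s = 0 ∨ s = 1 := by omega
    all_goals obtain rfl | rfl : t = 0 ∨ t = 1 := by omega
    all_goals simp [an_cr_apply]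
    exact sub_eq_neg_add _ _
  refine LinearMap.ext fun x => ?_
  rw [← sum_cr_an x, ← sum_cr_an (an (n + 1) 0 x), ← sum_cr_an (an (n + 1) 1 x)]
  simp only [map_add, key]

/-- The last factor is untouched by `b ⊗ 1`, so `cap` only pairs equal indices; the signs of `cup`
and `cap` then cancel. -/
theorem cap_ext_cup {n : ℕ} (b : Module.End ℂ (VT (n + 1))) :
    cap n ∘ₗ ext 1 b ∘ₗ cup n = (2 : ℂ) • condExp b := by
  rw [two_condExp]
  refine LinearMap.ext fun x => ?_
  simp only [cap, cup, LinearMap.comp_apply, LinearMap.sub_apply, LinearMap.add_apply, map_sub,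
    ext_cr, an_cr_apply]
  simp

theorem ext_ext_cup {n : ℕ} (a : Module.End ℂ (VT n)) (x : VT n) :
    ext 1 (ext 1 a) (cup n x) = cup n (a x) := by
  simp only [cup, LinearMap.sub_apply, LinearMap.comp_apply, map_sub, ext_cr]

theorem e_ext_e {n : ℕ} (h1 : 1 ≤ n + 1) (h2 : n + 1 < n + 1 + 1)
    (b : Module.End ℂ (VT (n + 1))) :
    e (n + 1 + 1) (n + 1) h1 h2 * ext 1 b * e (n + 1 + 1) (n + 1) h1 h2 =
      ext 1 (ext 1 ((2 : ℂ) • condExp b)) * e (n + 1 + 1) (n + 1) h1 h2 := by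
  refine LinearMap.ext fun x => ?_
  simp only [e_eq, Module.End.mul_apply, LinearMap.comp_apply, ext_ext_cup, ← cap_ext_cup]

theorem two_condExp_ext {n : ℕ} (a : Module.End ℂ (VT n)) :
    (2 : ℂ) • condExp (ext 1 a) = (2 : ℂ) • a := by
  rw [two_condExp]
  refine LinearMap.ext fun x => ?_
  simp only [LinearMap.comp_apply, LinearMap.add_apply, ext_cr, an_cr_apply, if_true, two_smul]

/-- Operators on the first `n + 1` factors slide out of the partial trace, and `2ε(e) = 1`. -/
theorem two_condExp_ext_mul_e_mul_ext {n : ℕ} (h1 : 1 ≤ n + 1) (h2 : n + 1 < n + 1 + 1)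
    (a b : Module.End ℂ (VT (n + 1))) :
    (2 : ℂ) • condExp (ext 1 a * e (n + 1 + 1) (n + 1) h1 h2 * ext 1 b) = a * b := by
  rw [two_condExp]
  refine LinearMap.ext fun x => ?_
  simp only [e_eq, LinearMap.comp_apply, LinearMap.add_apply, Module.End.mul_apply, ext_cr, an_ext,
    ← map_add]
  congr 1
  simp only [cup, cap, LinearMap.comp_apply, LinearMap.sub_apply, map_sub, an_cr_apply]
  simp
  exact (add_comm _ _).trans (sum_cr_an (b x))

theorem condExp_sub {n : ℕ} (a b : Module.End ℂ (VT (n + 1))) :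
    (2 : ℂ) • condExp (a - b) = (2 : ℂ) • condExp a - (2 : ℂ) • condExp b := by
  simp only [two_condExp, LinearMap.sub_comp, LinearMap.comp_sub]
  abel

theorem condExp_smul {n : ℕ} (c : ℂ) (a : Module.End ℂ (VT (n + 1))) :
    (2 : ℂ) • condExp (c • a) = c • (2 : ℂ) • condExp a := by
  simp only [two_condExp, LinearMap.smul_comp, LinearMap.comp_smul, smul_add]

/-- The operators act on disjoint positions: counted from 0, the swap involves `j - 1` and `j`, both
at least `n`, hence is a swap `s'` inside the last `m` factors. -/
theorem commute_ext_e {n m j : ℕ} (a : Module.End ℂ (VT n)) (h1 : 1 ≤ j) (hj : n < j)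
    (h2 : j < n + m) : Commute (ext m a) (e (n + m) j h1 h2) := by
  set s := Equiv.swap (⟨j - 1, by omega⟩ : Fin (n + m)) ⟨j, h2⟩ with hs
  set s' := Equiv.swap (⟨j - 1 - n, by omega⟩ : Fin m) ⟨j - n, by omega⟩ with hs'
  have e1 : (⟨j - 1, by omega⟩ : Fin (n + m)) = Fin.natAdd n ⟨j - 1 - n, by omega⟩ := by
    ext; simp; omega
  have e2 : (⟨j, h2⟩ : Fin (n + m)) = Fin.natAdd n ⟨j - n, by omega⟩ := by
    ext; simp; omega
  have key (x : VT n) (w : Fin m → V) :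
      PiTensorProduct.reindex ℂ (fun _ : Fin (n + m) => V) s (TensorPower.mulEquiv (R := ℂ)
        (x ⊗ₜ[ℂ] PiTensorProduct.tprod ℂ w)) =
      TensorPower.mulEquiv (R := ℂ) (x ⊗ₜ[ℂ] PiTensorProduct.tprod ℂ (w ∘ s')) := by
    induction x using PiTensorProduct.induction_on with
    | smul_tprod r u =>
      simp only [← TensorProduct.smul_tmul', map_smul, mulEquiv_tprod]
      congr 1
      refine (PiTensorProduct.reindex_tprod _ _).trans ?_
      congr 1
      ext i : 1
      rw [hs, hs', Equiv.symm_swap, e1, e2]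
      refine Fin.addCases (fun i => ?_) (fun i => ?_) i
      · rw [Equiv.swap_apply_of_ne_of_ne]
        · simp
        · simp [Fin.ext_iff]; omega
        · simp [Fin.ext_iff]; omega
      · rw [(Fin.natAdd_injective m n).swap_apply]
        simp
    | add x y hx hy => simp only [TensorProduct.add_tmul, map_add, hx, hy]
  refine LinearMap.ext fun z => ?_
  refine (map_sub (ext m a) _ _).trans (congrArg (ext m a z - ·) ?_)
  obtain ⟨z, rfl⟩ := (TensorPower.mulEquiv (R := ℂ) (M := V) (n := n) (m := m)).surjective z
  induction z using TensorProduct.induction_on with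
  | zero => simp
  | add x y hx hy => simp only [map_add, hx, hy]
  | tmul x y =>
    induction y using PiTensorProduct.induction_on with
    | add x y hx hy => simp only [TensorProduct.tmul_add, map_add, hx, hy]
    | smul_tprod r w =>
      simp only [TensorProduct.tmul_smul, map_smul]
      congr 1
      rw [← hs]
      simp only [LinearEquiv.coe_coe, ext_mulEquiv, key]

/-! ### Equivariance under the group. -/

theorem tensorRep_append {G : Subgroup SU2} {n : ℕ} (g : G) (v : V) (x : VT n) :
    tensorRep G (n + 1) g (append n v x) = append n (defRep G g v) (tensorRep G n g x) := by
  induction x using PiTensorProduct.induction_on with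
  | add x y hx hy => simp only [map_add, hx, hy]
  | smul_tprod r u =>
    simp only [map_smul]
    congr 1
    rw [append_tprod]
    refine (PiTensorProduct.map_tprod _ _).trans ?_
    refine Eq.trans ?_ (congrArg (append n (defRep G g v)) (PiTensorProduct.map_tprod _ _)).symm
    rw [append_tprod]
    congr 1
    ext i : 1
    refine Fin.lastCases ?_ (fun i => ?_) i <;> simp

/-- The matrix entries of a group element. -/
def entry {G : Subgroup SU2} (g : G) (s t : Fin 2) : ℂ := ((g : SU2) : Matrix (Fin 2) (Fin 2) ℂ) s t

theorem entry_det {G : Subgroup SU2} (g : G) :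
    entry g 0 0 * entry g 1 1 - entry g 0 1 * entry g 1 0 = 1 := by
  rw [entry, entry, entry, entry, ← Matrix.det_fin_two]
  exact (Matrix.mem_specialUnitaryGroup_iff.1 (g : SU2).2).2

theorem defRep_basis {G : Subgroup SU2} (g : G) (t : Fin 2) :
    defRep G g (Pi.basisFun ℂ (Fin 2) t) =
      entry g 0 t • Pi.basisFun ℂ (Fin 2) 0 + entry g 1 t • Pi.basisFun ℂ (Fin 2) 1 := by
  ext i
  fin_cases i <;> simp [defRep, entry]

theorem tensorRep_cr {G : Subgroup SU2} {n : ℕ} (g : G) (t : Fin 2) (x : VT n) :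
    tensorRep G (n + 1) g (cr n t x) =
      entry g 0 t • cr n 0 (tensorRep G n g x) + entry g 1 t • cr n 1 (tensorRep G n g x) := by
  rw [cr, tensorRep_append, defRep_basis, map_add, map_smul, map_smul]
  rfl

/-- An element `g` scales the antisymmetric vector by `det g = 1`; this is where `SU₂` enters. -/
theorem tensorRep_cup {G : Subgroup SU2} {n : ℕ} (g : G) (x : VT n) :
    tensorRep G (n + 1 + 1) g (cup n x) = cup n (tensorRep G n g x) := by
  have h := entry_det g
  simp only [cup, LinearMap.sub_apply, LinearMap.comp_apply, map_sub, tensorRep_cr, map_add,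
    map_smul]
  conv_rhs => rw [← one_smul ℂ (cr (n + 1) 1 _), ← one_smul ℂ (cr (n + 1) 0 _), ← h]
  module

theorem cap_tensorRep {G : Subgroup SU2} {n : ℕ} (g : G) (x : VT (n + 1 + 1)) :
    cap n (tensorRep G (n + 1 + 1) g x) = tensorRep G n g (cap n x) := by
  have h := entry_det g
  have key (s t : Fin 2) (x : VT n) : cap n (tensorRep G (n + 1 + 1) g (cr (n + 1) t (cr n s x))) =
      tensorRep G n g (cap n (cr (n + 1) t (cr n s x))) := by
    simp only [cap, LinearMap.sub_apply, LinearMap.comp_apply, map_sub, tensorRep_cr, map_add,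
      map_smul, an_cr_apply]
    obtain rfl | rfl : s = 0 ∨ s = 1 := by omega
    all_goals obtain rfl | rfl : t = 0 ∨ t = 1 := by omega
    all_goals simp [an_cr_apply]
    · module
    · conv_rhs => rw [← one_smul ℂ (tensorRep G n g x), ← h]
      module
    · conv_rhs => rw [← one_smul ℂ (tensorRep G n g x), ← h]
      module
    · module
  rw [← sum_cr_an x, ← sum_cr_an (an (n + 1) 0 x), ← sum_cr_an (an (n + 1) 1 x)]
  simp only [map_add, key]

theorem mem_Z_iff {G : Subgroup SU2} {n : ℕ} {f : Module.End ℂ (VT n)} :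
    f ∈ Z G n ↔ ∀ g x, tensorRep G n g (f x) = f (tensorRep G n g x) := by
  simp only [Z, Subalgebra.mem_centralizer_iff, Set.forall_mem_range]
  exact forall_congr' fun g => LinearMap.ext_iff

/-- Extending an equivariant endomorphism by the identity keeps it equivariant. -/
theorem ext_mem_Z {G : Subgroup SU2} {n : ℕ} {f : Module.End ℂ (VT n)} (hf : f ∈ Z G n) :
    ext 1 f ∈ Z G (n + 1) := by
  rw [mem_Z_iff] at hf ⊢
  intro g x
  rw [← sum_cr_an x]
  simp only [map_add, map_smul, ext_cr, tensorRep_cr, hf]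

/-- The equivariant map `x ↦ x ⊗ v₀ ⊗ v₁ - x ⊗ v₁ ⊗ v₀`. -/
def cupHom (G : Subgroup SU2) (n : ℕ) :
    (tensorRep G n).IntertwiningMap (tensorRep G (n + 1 + 1)) :=
  ⟨cup n, fun g => LinearMap.ext fun x => (tensorRep_cup g x).symm⟩

/-- Contraction against the determinant form as an equivariant map. -/
def capHom (G : Subgroup SU2) (n : ℕ) :
    (tensorRep G (n + 1 + 1)).IntertwiningMap (tensorRep G n) :=
  ⟨cap n, fun g => LinearMap.ext fun x => cap_tensorRep g x⟩

/-! ### Splittings and Schur's lemma. -/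

/-- A projection onto a module that lies in the centralizer algebra splits equivariantly. -/
theorem ProjectsOnto.exists_splitting {G : Subgroup SU2} {n : ℕ} {f : Module.End ℂ (VT n)}
    {W : Type*} [AddCommGroup W] [Module ℂ W] {ρ : Representation ℂ G W} (hf : f ∈ Z G n)
    (h : ProjectsOnto f ρ) :
    ∃ (i : ρ.IntertwiningMap (tensorRep G n)) (p : (tensorRep G n).IntertwiningMap ρ),
      (∀ w, p (i w) = w) ∧ ∀ x, i (p x) = f x := by
  obtain ⟨hid, i, hi, hr⟩ := h
  have hmem (x : VT n) : f x ∈ LinearMap.range i.toLinearMap := hr ▸ LinearMap.mem_range_self f x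
  have hfi (w : W) : f (i w) = i w := by
    obtain ⟨x, hx⟩ : i w ∈ LinearMap.range f := hr ▸ LinearMap.mem_range_self i.toLinearMap w
    rw [← hx]
    exact LinearMap.congr_fun hid x
  let E := LinearEquiv.ofInjective i.toLinearMap hi
  let p : VT n →ₗ[ℂ] W := E.symm.toLinearMap ∘ₗ f.codRestrict _ hmem
  have hip (x : VT n) : i (p x) = f x :=
    congrArg Subtype.val (E.apply_symm_apply (f.codRestrict _ hmem x))
  have hp (g : G) (x : VT n) : p (tensorRep G n g x) = ρ g (p x) := by
    -- After the injective `i`, equivariance of `p` becomes commutation of `f` with `G`.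
    apply hi
    rw [hip, i.isIntertwining, hip, mem_Z_iff.1 hf]
  refine ⟨i, ⟨p, fun g => LinearMap.ext (hp g)⟩, fun w => hi ?_, hip⟩
  exact (hip _).trans (hfi w)

/-- If `f` splits through `ρ`, then `f ⊗ 1` splits through `ρ ⊗ V`. -/
theorem exists_splitting_ext {G : Subgroup SU2} {n : ℕ} {f : Module.End ℂ (VT n)}
    {W : Type*} [AddCommGroup W] [Module ℂ W] {ρ : Representation ℂ G W}
    (i : ρ.IntertwiningMap (tensorRep G n)) (p : (tensorRep G n).IntertwiningMap ρ)
    (hpi : ∀ w, p (i w) = w) (hip : ∀ x, i (p x) = f x) :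
    ∃ (j : (ρ.tprod (defRep G)).IntertwiningMap (tensorRep G (n + 1)))
      (q : (tensorRep G (n + 1)).IntertwiningMap (ρ.tprod (defRep G))),
      (∀ w, q (j w) = w) ∧ ∀ x, j (q x) = ext 1 f x := by
  let j : W ⊗[ℂ] V →ₗ[ℂ] VT (n + 1) := TensorProduct.lift ((append n).flip ∘ₗ i.toLinearMap)
  have hj (w : W) (v : V) : j (w ⊗ₜ v) = append n v (i w) := rfl
  let q : VT (n + 1) →ₗ[ℂ] W ⊗[ℂ] V :=
    (TensorProduct.mk ℂ W V).flip (Pi.basisFun ℂ (Fin 2) 0) ∘ₗ p.toLinearMap ∘ₗ an n 0 +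
    (TensorProduct.mk ℂ W V).flip (Pi.basisFun ℂ (Fin 2) 1) ∘ₗ p.toLinearMap ∘ₗ an n 1
  have hq (x : VT (n + 1)) : q x = p (an n 0 x) ⊗ₜ Pi.basisFun ℂ (Fin 2) 0 +
      p (an n 1 x) ⊗ₜ Pi.basisFun ℂ (Fin 2) 1 := rfl
  have hjq (x : VT (n + 1)) : j (q x) = ext 1 f x := by
    rw [hq, map_add, hj, hj, hip, hip, ext_eq]
    rfl
  have hqj : q ∘ₗ j = LinearMap.id := by
    refine TensorProduct.ext (LinearMap.ext fun w => (Pi.basisFun ℂ (Fin 2)).ext fun t => ?_)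
    change q (j (w ⊗ₜ _)) = w ⊗ₜ _
    rw [hj, hq]
    change p (an n 0 (cr n t _)) ⊗ₜ _ + p (an n 1 (cr n t _)) ⊗ₜ _ = _
    obtain rfl | rfl : t = 0 ∨ t = 1 := by omega
    all_goals simp [an_cr_apply, hpi]
  have hqj' (w : W ⊗[ℂ] V) : q (j w) = w := LinearMap.congr_fun hqj w
  have hjg (g : G) : j ∘ₗ (ρ.tprod (defRep G)) g = tensorRep G (n + 1) g ∘ₗ j := by
    refine TensorProduct.ext' fun w v => ?_
    rw [LinearMap.comp_apply, LinearMap.comp_apply, hj, tensorRep_append, ← i.isIntertwining]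
    rfl
  have hf : f ∈ Z G n := mem_Z_iff.2 fun g x => by
    rw [← hip, ← hip, p.isIntertwining, i.isIntertwining]
  have hqg (g : G) (x : VT (n + 1)) : q (tensorRep G (n + 1) g x) = (ρ.tprod (defRep G)) g (q x) := by
    apply (Function.LeftInverse.injective hqj' : Function.Injective j)
    rw [hjq, ← mem_Z_iff.1 (ext_mem_Z hf), ← hjq]
    exact (LinearMap.congr_fun (hjg g) (q x)).symm
  exact ⟨⟨j, hjg⟩, ⟨q, fun g => LinearMap.ext (hqg g)⟩, hqj', hjq⟩

theorem IsSummand.of_bijective {G : Subgroup SU2} {n : ℕ} {W W' : Type*} [AddCommGroup W]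
    [Module ℂ W] [AddCommGroup W'] [Module ℂ W'] {ρ : Representation ℂ G W}
    {ρ' : Representation ℂ G W'} (h : IsSummand ρ n) (f : ρ.IntertwiningMap ρ')
    (hf : Function.Bijective f) : IsSummand ρ' n := by
  obtain ⟨i, p, hpi⟩ := h
  let φ := f.ofBijective hf
  refine ⟨i.comp φ.symm.toIntertwiningMap, f.comp p, fun w => ?_⟩
  change f (p (i (φ.symm w))) = w
  rw [hpi]
  exact φ.apply_symm_apply w

/-- A nonzero map between irreducibles is an isomorphism and would carry the summand property over
to `ρ'`. -/
theorem eq_zero_of_isSummand {G : Subgroup SU2} {n : ℕ} {W W' : Type*} [AddCommGroup W]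
    [Module ℂ W] [AddCommGroup W'] [Module ℂ W'] {ρ : Representation ℂ G W}
    {ρ' : Representation ℂ G W'} (hρ : ρ.IsIrreducible) (hρ' : ρ'.IsIrreducible)
    (h : IsSummand ρ n) (h' : ¬ IsSummand ρ' n) (f : ρ.IntertwiningMap ρ') : f = 0 :=
  (Representation.IsIrreducible.bijective_or_eq_zero f).resolve_left fun hf =>
    h' (h.of_bijective f hf)

theorem eq_zero_of_isSummand' {G : Subgroup SU2} {n : ℕ} {W W' : Type*} [AddCommGroup W]
    [Module ℂ W] [AddCommGroup W'] [Module ℂ W'] {ρ : Representation ℂ G W}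
    {ρ' : Representation ℂ G W'} (hρ : ρ.IsIrreducible) (hρ' : ρ'.IsIrreducible)
    (h : IsSummand ρ n) (h' : ¬ IsSummand ρ' n) (f : ρ'.IntertwiningMap ρ) : f = 0 :=
  (Representation.IsIrreducible.bijective_or_eq_zero f).resolve_left fun hf =>
    h' (h.of_bijective (f.ofBijective hf).symm.toIntertwiningMap
      (f.ofBijective hf).symm.toLinearEquiv.bijective)

/-- If `b ∘ a` were invertible, `(b ∘ a)⁻¹ ∘ b` would split `a`. -/
theorem comp_eq_zero_of_not_isSummand {G : Subgroup SU2} {n : ℕ} {W : Type*} [AddCommGroup W]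
    [Module ℂ W] {ρ : Representation ℂ G W} (hρ : ρ.IsIrreducible) (h : ¬ IsSummand ρ n)
    (a : ρ.IntertwiningMap (tensorRep G n)) (b : (tensorRep G n).IntertwiningMap ρ) :
    b.comp a = 0 :=
  (Representation.IsIrreducible.bijective_or_eq_zero (b.comp a)).resolve_left fun hf =>
    h ⟨a, ((b.comp a).ofBijective hf).symm.toIntertwiningMap.comp b,
      ((b.comp a).ofBijective hf).symm_apply_apply⟩

theorem IsSummand.finite {G : Subgroup SU2} {n : ℕ} {W : Type*} [AddCommGroup W]
    [Module ℂ W] {ρ : Representation ℂ G W} (h : IsSummand ρ n) : Module.Finite ℂ W := by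
  obtain ⟨i, p, hpi⟩ := h
  have : Module.Finite ℂ (VT n) := Module.Finite.of_basis (stdBasis n)
  exact Module.Finite.of_surjective p.toLinearMap fun w => ⟨i w, hpi w⟩

theorem nontrivial_of_isIrreducible {G : Subgroup SU2} {W : Type*} [AddCommGroup W]
    [Module ℂ W] {ρ : Representation ℂ G W} (h : ρ.IsIrreducible) : Nontrivial W := by
  rw [Representation.irreducible_iff_isSimpleModule_asModule] at h
  exact IsSimpleModule.nontrivial (MonoidAlgebra ℂ G) ρ.asModule

theorem trace_of_splitting {n : ℕ} {W : Type*} [AddCommGroup W] [Module ℂ W] [Module.Finite ℂ W]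
    (i : W →ₗ[ℂ] VT n) (p : VT n →ₗ[ℂ] W) (h : ∀ w, p (i w) = w) :
    LinearMap.trace ℂ _ (i ∘ₗ p) = Module.finrank ℂ W := by
  have : Module.Finite ℂ (VT n) := Module.Finite.of_basis (stdBasis n)
  rw [LinearMap.trace_comp_comm', ← LinearMap.trace_id ℂ W]
  exact congrArg _ (LinearMap.ext h)

/-- If `F` is the sum of the projections onto two irreducible modules, of which only the first is
a summand of `V^{⊗ n}`, then an endomorphism `F b a F` that factors through `V^{⊗ n}` is a multiple
of the first projection. -/
theorem exists_eq_smul_of_factors {G : Subgroup SU2} {n m : ℕ}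
    {L N : Type*} [AddCommGroup L] [Module ℂ L] [AddCommGroup N] [Module ℂ N]
    {ρL : Representation ℂ G L} {ρN : Representation ℂ G N}
    (hL : ρL.IsIrreducible) (hN : ρN.IsIrreducible)
    (hLs : IsSummand ρL n) (hNs : ¬ IsSummand ρN n)
    (iL : ρL.IntertwiningMap (tensorRep G m)) (pL : (tensorRep G m).IntertwiningMap ρL)
    (iN : ρN.IntertwiningMap (tensorRep G m)) (pN : (tensorRep G m).IntertwiningMap ρN)
    (a : (tensorRep G m).IntertwiningMap (tensorRep G n))
    (b : (tensorRep G n).IntertwiningMap (tensorRep G m))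
    (F : Module.End ℂ (VT m)) (hF : ∀ x, F x = iL (pL x) + iN (pN x)) :
    ∃ c : ℂ, ∀ x, F (b (a (F x))) = c • iL (pL x) := by
  have := hLs.finite
  -- Over `ℂ` a finite-dimensional irreducible module has only scalar endomorphisms.
  obtain ⟨c, hc⟩ := (Representation.IsIrreducible.algebraMap_intertwiningMap_bijective_of_isAlgClosed
    (ρ := ρL)).2 ((pL.comp b).comp (a.comp iL))
  have hLL (x : L) : pL (b (a (iL x))) = c • x := (DFunLike.congr_fun hc x).symm
  have hLN (x : L) : pN (b (a (iL x))) = 0 :=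
    DFunLike.congr_fun (eq_zero_of_isSummand hL hN hLs hNs ((pN.comp b).comp (a.comp iL))) x
  have hNL (x : N) : pL (b (a (iN x))) = 0 :=
    DFunLike.congr_fun (eq_zero_of_isSummand' hL hN hLs hNs ((pL.comp b).comp (a.comp iN))) x
  have hNN (x : N) : pN (b (a (iN x))) = 0 :=
    DFunLike.congr_fun (comp_eq_zero_of_not_isSummand hN hNs (a.comp iN) (pN.comp b)) x
  refine ⟨c, fun x => ?_⟩
  rw [hF (b _), hF x]
  simp only [map_add, hLL, hLN, hNL, hNN, map_zero, add_zero, map_smul]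

theorem two_mul_finrank_eq {G : Subgroup SU2} {L M N : Type*} [AddCommGroup L] [Module ℂ L]
    [AddCommGroup M] [Module ℂ M] [AddCommGroup N] [Module ℂ N] [Module.Finite ℂ L]
    [Module.Finite ℂ M] [Module.Finite ℂ N] {ρL : Representation ℂ G L}
    {ρM : Representation ℂ G M} {ρN : Representation ℂ G N}
    (φ : (ρM.tprod (defRep G)).Equiv (ρL.prod ρN)) :
    2 * (Module.finrank ℂ M : ℂ) = Module.finrank ℂ L + Module.finrank ℂ N := by
  have h := φ.toLinearEquiv.finrank_eq
  rw [Module.finrank_tensorProduct, Module.finrank_prod, Module.finrank_fin_fun, mul_comm] at h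
  exact_mod_cast h

/-! ### The projection onto the new summand. -/

/-- The equivariant splitting of `f_ν`, together with that of `f_μ ⊗ 1`. -/
theorem exists_splitting_sub_smul (G : Subgroup SU2) (k : ℕ)
    {L M N : Type*} [AddCommGroup L] [Module ℂ L] [AddCommGroup M] [Module ℂ M]
    [AddCommGroup N] [Module ℂ N]
    {ρL : Representation ℂ G L} {ρM : Representation ℂ G M} {ρN : Representation ℂ G N}
    (hL : ρL.IsIrreducible) (hM : ρM.IsIrreducible) (hN : ρN.IsIrreducible)
    (hLs : IsSummand ρL k) (hMs : IsSummand ρM (k + 1)) (hNs : ¬ IsSummand ρN k)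
    (fM : Module.End ℂ (VT (k + 1))) (hfMZ : fM ∈ Z G (k + 1)) (hfM : ProjectsOnto fM ρM)
    (φ : (ρM.tprod (defRep G)).Equiv (ρL.prod ρN)) (h1 : 1 ≤ k + 1) (h2 : k + 1 < k + 1 + 1) :
    ∃ (iN : ρN.IntertwiningMap (tensorRep G (k + 1 + 1)))
      (pN : (tensorRep G (k + 1 + 1)).IntertwiningMap ρN),
      (∀ w, pN (iN w) = w) ∧ (∀ w, ext 1 fM (iN w) = iN w) ∧ (∀ x, pN (ext 1 fM x) = pN x) ∧
      ∀ x, (ext 1 fM - ((Module.finrank ℂ L : ℂ) / (Module.finrank ℂ M : ℂ)) •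
        (ext 1 fM * e (k + 1 + 1) (k + 1) h1 h2 * ext 1 fM)) x = iN (pN x) := by
  have := hLs.finite
  have := hMs.finite
  have := nontrivial_of_isIrreducible hM
  obtain ⟨i, p, hpi, hip⟩ := hfM.exists_splitting hfMZ
  obtain ⟨j, q, hqj, hjq⟩ := exists_splitting_ext i p hpi hip
  let iL := (j.comp φ.symm.toIntertwiningMap).comp (.inl ℂ ρL ρN)
  let pL := (Representation.IntertwiningMap.fst ℂ ρL ρN).comp (φ.toIntertwiningMap.comp q)
  let iN := (j.comp φ.symm.toIntertwiningMap).comp (.inr ℂ ρL ρN)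
  let pN := (Representation.IntertwiningMap.snd ℂ ρL ρN).comp (φ.toIntertwiningMap.comp q)
  have hiL (x : L) : iL x = j (φ.symm (x, 0)) := rfl
  have hiN (x : N) : iN x = j (φ.symm (0, x)) := rfl
  have hpL (x) : pL x = (φ (q x)).1 := rfl
  have hpN (x) : pN x = (φ (q x)).2 := rfl
  have hpiL (x : L) : pL (iL x) = x := by
    rw [hpL, hiL, hqj, φ.apply_symm_apply]
  have hpiN (x : N) : pN (iN x) = x := by
    rw [hpN, hiN, hqj, φ.apply_symm_apply]
  have hF (x) : ext 1 fM x = iL (pL x) + iN (pN x) := by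
    rw [hiL, hiN, hpL, hpN, ← map_add, ← map_add, Prod.mk_add_mk, add_zero, zero_add, Prod.mk.eta,
      φ.symm_apply_apply, hjq]
  obtain ⟨c, hc⟩ := exists_eq_smul_of_factors hL hN hLs hNs iL pL iN pN (capHom G k) (cupHom G k)
    (ext 1 fM) hF
  have hT : ext 1 fM * e (k + 1 + 1) (k + 1) h1 h2 * ext 1 fM =
      c • (iL.toLinearMap ∘ₗ pL.toLinearMap) := by
    rw [e_eq]
    exact LinearMap.ext hc
  -- Two computations of one trace: `c d^λ` from the Schur form, and `tr(f_μ f_μ) = d^μ` from the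
  -- partial trace.
  have htr : c * Module.finrank ℂ L = Module.finrank ℂ M := by
    have h := trace_eq (ext 1 fM * e (k + 1 + 1) (k + 1) h1 h2 * ext 1 fM)
    rw [two_condExp_ext_mul_e_mul_ext, hfM.1.eq, hT, map_smul, trace_of_splitting _ _ hpiL] at h
    rw [← smul_eq_mul, h, ← trace_of_splitting _ _ hpi]
    exact congrArg _ (LinearMap.ext fun x => (hip x).symm)
  have hM0 : (Module.finrank ℂ M : ℂ) ≠ 0 := Nat.cast_ne_zero.2 Module.finrank_pos.ne'
  refine ⟨iN, pN, hpiN, fun w => ?_, fun x => ?_, fun x => ?_⟩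
  · rw [hiN, ← hjq, hqj]
  · rw [hpN, hpN, ← hjq, hqj]
  -- The coefficient `d^λ / d^μ` is exactly `c⁻¹`, so the whole `G^λ` part is removed.
  · rw [hT, LinearMap.sub_apply, LinearMap.smul_apply, LinearMap.smul_apply, smul_smul, hF,
      div_mul_eq_mul_div, mul_comm, htr, div_self hM0, one_smul]
    exact add_sub_cancel_left _ _

end McKay

end

theorem mainTheorem12 (G : Subgroup McKay.SU2) (k : ℕ)
    {L M N : Type*} [AddCommGroup L] [Module ℂ L] [AddCommGroup M] [Module ℂ M]
    [AddCommGroup N] [Module ℂ N]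
    (ρL : Representation ℂ G L) (ρM : Representation ℂ G M) (ρN : Representation ℂ G N)
    (hL : ρL.IsIrreducible) (hM : ρM.IsIrreducible) (hN : ρN.IsIrreducible)
    (hLnew : McKay.IsNew ρL k) (hMnew : McKay.IsNew ρM (k + 1))
    (hNnew : McKay.IsNew ρN (k + 1 + 1))
    (fL : Module.End ℂ (McKay.VT k)) (hfLZ : fL ∈ McKay.Z G k)
    (hfL : McKay.ProjectsOnto fL ρL)
    (fM : Module.End ℂ (McKay.VT (k + 1))) (hfMZ : fM ∈ McKay.Z G (k + 1))
    (hfM : McKay.ProjectsOnto fM ρM)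
    (hMV : Nonempty ((ρM.tprod (McKay.defRep G)).Equiv (ρL.prod ρN)))
    (fN : Module.End ℂ (McKay.VT (k + 1 + 1)))
    (hfN : fN = McKay.ext 1 fM - ((Module.finrank ℂ L : ℂ) / (Module.finrank ℂ M : ℂ)) •
      (McKay.ext 1 fM * McKay.e (k + 1 + 1) (k + 1) (by omega) (by omega) * McKay.ext 1 fM)) :
    (fN ∈ McKay.Z G (k + 1 + 1) ∧ IsIdempotentElem fN) ∧
    (McKay.ext 1 fM * fN = fN ∧ fN * McKay.ext 1 fM = fN) ∧
    (∀ (m j : ℕ) (hj : k + 2 < j) (hjm : j < k + 1 + 1 + m),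
      Commute (McKay.ext m fN) (McKay.e (k + 1 + 1 + m) j (by omega) hjm)) ∧
    (McKay.e (k + 1 + 1 + 1) (k + 2) (by omega) (by omega) * McKay.ext 1 fN *
        McKay.e (k + 1 + 1 + 1) (k + 2) (by omega) (by omega) =
      ((Module.finrank ℂ N : ℂ) / (Module.finrank ℂ M : ℂ)) •
        (McKay.ext 1 (McKay.ext 1 fM) *
          McKay.e (k + 1 + 1 + 1) (k + 2) (by omega) (by omega)) ∧
      McKay.condExp fN =
        ((Module.finrank ℂ N : ℂ) / (2 * (Module.finrank ℂ M : ℂ))) • fM) ∧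
    McKay.ProjectsOnto fN ρN := by
  obtain ⟨φ⟩ := hMV
  have hLs := hLnew.1
  have hMs := hMnew.1
  have := hLs.finite
  have := hMs.finite
  have := hNnew.1.finite
  have := McKay.nontrivial_of_isIrreducible hM
  have hM0 : (Module.finrank ℂ M : ℂ) ≠ 0 := Nat.cast_ne_zero.2 Module.finrank_pos.ne'
  have hdim := McKay.two_mul_finrank_eq φ
  obtain ⟨i, p, hpi, hfi, hpf, hip⟩ := McKay.exists_splitting_sub_smul G k hL hM hN hLs hMs
    -- Newness in `V^{⊗(k+2)}` says that `G^ν` does not occur in `V^{⊗k}`.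
    (hNnew.2 k rfl) fM hfMZ hfM φ (by omega) (by omega)
  rw [← hfN] at hip
  have hidem : IsIdempotentElem fN := LinearMap.ext fun x => by
    rw [Module.End.mul_apply, hip, hip, hpi]
  have hE : (2 : ℂ) • McKay.condExp fN =
      ((Module.finrank ℂ N : ℂ) / (Module.finrank ℂ M : ℂ)) • fM := by
    rw [hfN, McKay.condExp_sub, McKay.condExp_smul, McKay.two_condExp_ext,
      McKay.two_condExp_ext_mul_e_mul_ext, hfM.1.eq]
    -- What remains is `2 - d^λ/d^μ = d^ν/d^μ`, the dimension count of `G^μ ⊗ V`.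
    refine (sub_smul _ _ fM).symm.trans ?_
    congr 1
    field_simp
    linear_combination hdim
  refine ⟨⟨McKay.mem_Z_iff.2 fun g x => ?_, hidem⟩, ⟨LinearMap.ext fun x => ?_,
    LinearMap.ext fun x => ?_⟩, fun m j hj hjm => McKay.commute_ext_e _ _ hj _,
    ⟨?_, ?_⟩, hidem, i, ?_, ?_⟩
  · rw [hip, hip, p.isIntertwining, i.isIntertwining]
  · rw [Module.End.mul_apply, hip, hfi]
  · rw [Module.End.mul_apply, hip, hip, hpf]
  · refine (McKay.e_ext_e _ _ _).trans ?_
    rw [hE, McKay.ext_smul, McKay.ext_smul]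
    exact smul_mul_assoc _ _ _
  · rw [mul_comm (2 : ℂ), ← div_div, div_eq_inv_mul _ (2 : ℂ), mul_smul, ← hE, smul_smul,
      inv_mul_cancel₀ two_ne_zero, one_smul]
  · exact Function.LeftInverse.injective hpi
  · refine le_antisymm ?_ ?_
    · rintro _ ⟨w, rfl⟩
      exact ⟨i w, by rw [hip, hpi]; rfl⟩
    · rintro _ ⟨x, rfl⟩
      exact ⟨p x, (hip x).symm⟩
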